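/- Let $k$ be a field with $\operatorname{char} k\neq 2$ and let $n\ge 0$. Let $E(n)$ be the Hopf algebra over $k$ generated as an associative unital algebra by $g,x_1,\dots,x_n$ with relations $g^2=1$, $x_i^2=0$, $gx_i=-x_ig$, and $x_ix_j=-x_jx_i$ for $i<j$, and with $$\Delta(g)=g\otimes g,\quad \Delta(x_i)=x_i\otimes g+1\otimes x_i,\quad \varepsilon(g)=1,\quad \varepsilon(x_i)=0,\quad S(g)=g,\quad S(x_i)=gx_i .$$ Let $A$ be a finite-dimensional associative unital $k$-algebra. A right $E(n)$-coaction on $A$ is a $k$-linear map $\rho:A\to A\otimes E(n)$ that makes $A$ a right $E(n)$-comodule and satisfies $\rho(ab)=\rho(a)\rho(b)$ and $\rho(1)=1\otimes 1$ (i.e. $(A,\rho)$ is a right $E(n)$-comodule algebra). Consider the tuples $(\varphi,d_1,\dots,d_n)$ in which $\varphi:A\to A$ is a $k$-algebra endomorphism with $\varphi^2=\mathrm{Id}_A$ (an involution) and each $d_i:A\to A$ is a $\varphi$-derivation (a $k$-linear map with $d_i(ab)=d_i(a)b+\varphi(a)d_i(b)$ for all $a,b\in A$), such that $d_i^2=0$,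 $\varphi d_i=-d_i\varphi$ and $d_id_j=-d_jd_i$ for all $i,j$. For $P=\{i_1<\dots<i_s\}\subseteq\{1,\dots,n\}$ write $x_P=x_{i_1}\cdots x_{i_s}$ and $d_P=d_{i_1}\circ\cdots\circ d_{i_s}$, with $x_\emptyset=1$ and $d_\emptyset=\mathrm{Id}_A$. Then the assignment $(\varphi,d_1,\dots,d_n)\mapsto\rho$, where $$\rho(a)=\sum_{P\subseteq\{1,\dots,n\}}(-1)^{\lfloor\frac{|P|+1}{2}\rfloor}\left[d_P(a)\otimes\frac{x_P+(-1)^{|P|}gx_P}{2}+\varphi(d_P(a))\otimes\frac{x_P+(-1)^{|P|+1}gx_P}{2}\right]\qquad(a\in A),$$ is a bijection from the set of these tuples onto the set of right $E(n)$-coactions on $A$. In particular, every right $E(n)$-comodule algebra structure on $A$ has this form, for exactly one such tuple. -/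

import Mathlib

open scoped TensorProduct

universe u v

noncomputable section

/-! ### Comodule algebras -/

section ComoduleAlgebra

variable {k : Type u} [CommRing k] {A : Type v} [Ring A] [Algebra k A]
variable {H : Type*} [Ring H]

/-- `ρ : A → A ⊗ H` is a (right) coaction of the Hopf algebra `H` on the algebra `A`, i.e. `(A, ρ)`
is a right `H`-comodule algebra: `(A, ρ)` is a right `H`-comodule (the first two fields),
`ρ (a b) = a₀ b₀ ⊗ a₁ b₁`, and `ρ 1 = 1 ⊗ 1`. -/
structure IsComoduleAlgebra [HopfAlgebra k H] (ρ : A →ₗ[k] A ⊗[k] H) : Prop where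
  coassoc : (TensorProduct.assoc k A H H).toLinearMap ∘ₗ ρ.rTensor H ∘ₗ ρ =
    (Coalgebra.comul (R := k) (A := H)).lTensor A ∘ₗ ρ
  counit : (TensorProduct.rid k A).toLinearMap ∘ₗ
    (Coalgebra.counit (R := k) (A := H)).lTensor A ∘ₗ ρ = LinearMap.id
  map_mul : ∀ a b : A, ρ (a * b) = ρ a * ρ b
  map_one : ρ 1 = 1 ⊗ₜ[k] 1

/-- An algebra endomorphism is an (algebra) involution if its square is the identity. -/
def IsAlgInvolution (φ : A →ₐ[k] A) : Prop :=
  ∀ a, φ (φ a) = a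

/-- `φ`-derivations: `d (a b) = d a * b + φ a * d b`. -/
def IsSkewDerivation (φ : A →ₐ[k] A) (d : Module.End k A) : Prop :=
  ∀ a b : A, d (a * b) = d a * b + φ a * d b

/-- Tuples `(φ, d₁, …, dₙ)`, where `φ` is an involution of `A` and the `dᵢ` are `φ`-derivations with
`dᵢ² = 0`, `φ dᵢ = - dᵢ φ` and `dᵢ dⱼ = - dⱼ dᵢ`. -/
structure IsInvolutionDerivationTuple {n : ℕ} (φ : A →ₐ[k] A) (d : Fin n → Module.End k A) :
    Prop where
  involution : IsAlgInvolution φ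
  derivation : ∀ i, IsSkewDerivation φ (d i)
  sq_zero : ∀ i a, d i (d i a) = 0
  anticomm_involution : ∀ i a, φ (d i a) = -d i (φ a)
  anticomm : ∀ i j a, d i (d j a) = -d j (d i a)

end ComoduleAlgebra

/-! ### The Hopf algebras `E(n)` -/

/-- The generators `g, x₁, …, xₙ` of `E(n)`. -/
inductive EGen (n : ℕ) : Type
  | g : EGen n
  | x (i : Fin n) : EGen n

/-- The defining relations `g² = 1`, `xᵢ² = 0`, `g xᵢ = - xᵢ g` and `xᵢ xⱼ = - xⱼ xᵢ` for `i < j`. -/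
inductive ERel (k : Type u) [CommRing k] (n : ℕ) :
    FreeAlgebra k (EGen n) → FreeAlgebra k (EGen n) → Prop
  | g_sq : ERel k n (FreeAlgebra.ι k .g * FreeAlgebra.ι k .g) 1
  | x_sq (i : Fin n) : ERel k n (FreeAlgebra.ι k (.x i) * FreeAlgebra.ι k (.x i)) 0
  | g_x (i : Fin n) : ERel k n (FreeAlgebra.ι k .g * FreeAlgebra.ι k (.x i))
      (-(FreeAlgebra.ι k (.x i) * FreeAlgebra.ι k .g))
  | x_x (i j : Fin n) (hij : i < j) : ERel k n (FreeAlgebra.ι k (.x i) * FreeAlgebra.ι k (.x j))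
      (-(FreeAlgebra.ι k (.x j) * FreeAlgebra.ι k (.x i)))

/-- The algebra `E(n)`, presented by generators and relations. -/
def EAlg (k : Type u) [CommRing k] (n : ℕ) : Type u :=
  RingQuot (ERel k n)

namespace EAlg

variable {k : Type u} [CommRing k] {n : ℕ}

instance : Ring (EAlg k n) := inferInstanceAs (Ring (RingQuot (ERel k n)))

instance : Algebra k (EAlg k n) := inferInstanceAs (Algebra k (RingQuot (ERel k n)))

variable (k n) in
/-- The projection of the free algebra onto `E(n)`. -/
def mk : FreeAlgebra k (EGen n) →ₐ[k] EAlg k n :=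
  RingQuot.mkAlgHom k (ERel k n)

variable (k n) in
/-- The generator `g` of `E(n)`. -/
def g : EAlg k n := mk k n (FreeAlgebra.ι k .g)

variable (k) in
/-- The generators `xᵢ` of `E(n)`. -/
def x (i : Fin n) : EAlg k n := mk k n (FreeAlgebra.ι k (.x i))

theorem g_mul_g : g k n * g k n = 1 := by
  have h : mk k n _ = mk k n _ := RingQuot.mkAlgHom_rel k (ERel.g_sq (k := k) (n := n))
  simpa [g] using h

theorem x_mul_self (i : Fin n) : x k i * x k i = 0 := by
  have h : mk k n _ = mk k n _ := RingQuot.mkAlgHom_rel k (ERel.x_sq (k := k) i)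
  simpa [x] using h

theorem g_mul_x (i : Fin n) : g k n * x k i = -(x k i * g k n) := by
  have h : mk k n _ = mk k n _ := RingQuot.mkAlgHom_rel k (ERel.g_x (k := k) i)
  simpa [g, x] using h

theorem x_mul_x (i j : Fin n) : x k i * x k j = -(x k j * x k i) := by
  have key : ∀ i j : Fin n, i < j → x k i * x k j = -(x k j * x k i) := by
    intro i j hij
    have h : mk k n _ = mk k n _ := RingQuot.mkAlgHom_rel k (ERel.x_x (k := k) i j hij)
    simpa [x] using h
  rcases lt_trichotomy i j with h | rfl | h
  · exact key i j h
  · simp [x_mul_self]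
  · rw [key j i h, neg_neg]

section lift

variable {B : Type*} [Ring B] [Algebra k B]

/-- The universal property of `E(n)`: an algebra map out of `E(n)` is given by images of the
generators that satisfy the defining relations. -/
def lift (G : B) (X : Fin n → B) (hG : G * G = 1) (hX : ∀ i, X i * X i = 0)
    (hGX : ∀ i, G * X i = -(X i * G)) (hXX : ∀ i j, i < j → X i * X j = -(X j * X i)) :
    EAlg k n →ₐ[k] B :=
  RingQuot.liftAlgHom k ⟨FreeAlgebra.lift k (fun t => match t with
    | .g => G
    | .x i => X i), by
      intro a b h
      cases h with
      | g_sq => simpa using hG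
      | x_sq i => simpa using hX i
      | g_x i => simpa using hGX i
      | x_x i j hij => simpa using hXX i j hij⟩

variable (G : B) (X : Fin n → B) (hG : G * G = 1) (hX : ∀ i, X i * X i = 0)
    (hGX : ∀ i, G * X i = -(X i * G)) (hXX : ∀ i j, i < j → X i * X j = -(X j * X i))

@[simp] theorem lift_g : lift (k := k) G X hG hX hGX hXX (g k n) = G := by
  unfold lift g mk
  erw [RingQuot.liftAlgHom_mkAlgHom_apply]
  simp

@[simp] theorem lift_x (i : Fin n) : lift (k := k) G X hG hX hGX hXX (x k i) = X i := by
  unfold lift x mk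
  erw [RingQuot.liftAlgHom_mkAlgHom_apply]
  simp

end lift

theorem algHom_ext {B : Type*} [Semiring B] [Algebra k B] {f f' : EAlg k n →ₐ[k] B}
    (hg : f (g k n) = f' (g k n)) (hx : ∀ i, f (x k i) = f' (x k i)) : f = f' := by
  refine RingQuot.ringQuot_ext' k f f' (FreeAlgebra.hom_ext ?_)
  funext t
  cases t with
  | g => exact hg
  | x i => exact hx i

theorem induction {p : EAlg k n → Prop} (halg : ∀ r, p (algebraMap k _ r)) (hg : p (g k n))
    (hx : ∀ i, p (x k i)) (hmul : ∀ a b, p a → p b → p (a * b))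
    (hadd : ∀ a b, p a → p b → p (a + b)) (a : EAlg k n) : p a := by
  obtain ⟨a, rfl⟩ : ∃ b, mk k n b = a := RingQuot.mkAlgHom_surjective k (ERel k n) a
  induction a using FreeAlgebra.induction with
  | grade0 r => rw [AlgHom.commutes]; exact halg r
  | grade1 t => cases t with
    | g => exact hg
    | x i => exact hx i
  | mul a b ha hb => rw [map_mul]; exact hmul _ _ ha hb
  | add a b ha hb => rw [map_add]; exact hadd _ _ ha hb

variable (k n) in
/-- The comultiplication: `Δ g = g ⊗ g` and `Δ xᵢ = xᵢ ⊗ g + 1 ⊗ xᵢ`. -/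
def comulHom : EAlg k n →ₐ[k] EAlg k n ⊗[k] EAlg k n :=
  lift (g k n ⊗ₜ g k n) (fun i => x k i ⊗ₜ g k n + 1 ⊗ₜ x k i)
    (by simp [g_mul_g, Algebra.TensorProduct.one_def])
    (fun i => by
      simp [mul_add, add_mul, x_mul_self, g_mul_x, TensorProduct.tmul_neg])
    (fun i => by
      simp only [mul_add, add_mul, Algebra.TensorProduct.tmul_mul_tmul, g_mul_x, mul_one, one_mul,
        TensorProduct.neg_tmul, TensorProduct.tmul_neg, neg_add])
    (fun i j _ => by
      simp only [mul_add, add_mul, Algebra.TensorProduct.tmul_mul_tmul, g_mul_x, mul_one, one_mul,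
        TensorProduct.tmul_neg, neg_add, x_mul_x i j, TensorProduct.neg_tmul]
      abel)

variable (k n) in
/-- The counit: `ε g = 1` and `ε xᵢ = 0`. -/
def counitHom : EAlg k n →ₐ[k] k :=
  lift 1 (fun _ => 0) (by simp) (by simp) (by simp) (by simp)

@[simp] theorem comulHom_g : comulHom k n (g k n) = g k n ⊗ₜ g k n := lift_g ..

@[simp] theorem comulHom_x (i : Fin n) :
    comulHom k n (x k i) = x k i ⊗ₜ g k n + 1 ⊗ₜ x k i := lift_x ..

@[simp] theorem counitHom_g : counitHom k n (g k n) = 1 := lift_g ..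

@[simp] theorem counitHom_x (i : Fin n) : counitHom k n (x k i) = 0 := lift_x ..

instance : Bialgebra k (EAlg k n) :=
  Bialgebra.ofAlgHom (comulHom k n) (counitHom k n)
    (algHom_ext (by simp) (fun i => by
      simp [TensorProduct.add_tmul, TensorProduct.tmul_add, add_assoc]
      simp [Algebra.TensorProduct.one_def]))
    (algHom_ext (by simp) (fun i => by simp))
    (algHom_ext (by simp) (fun i => by simp))

theorem comul_eq (a : EAlg k n) : Coalgebra.comul (R := k) a = comulHom k n a := rfl

theorem counit_eq (a : EAlg k n) : Coalgebra.counit (R := k) a = counitHom k n a := rfl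

variable (k n) in
/-- The antipode as an algebra map into the opposite algebra: `S g = g` and `S xᵢ = g xᵢ`. -/
def antipodeHom : EAlg k n →ₐ[k] (EAlg k n)ᵐᵒᵖ :=
  lift (MulOpposite.op (g k n)) (fun i => MulOpposite.op (g k n * x k i))
    (by simp [← MulOpposite.op_mul, g_mul_g])
    (fun i => by
      rw [← MulOpposite.op_mul, mul_assoc, ← mul_assoc (x k i), ← neg_eq_iff_eq_neg.2 (g_mul_x i)]
      simp [mul_assoc, x_mul_self])
    (fun i => by
      rw [← MulOpposite.op_mul, ← MulOpposite.op_mul, ← MulOpposite.op_neg]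
      congr 1
      rw [mul_assoc, g_mul_x i, mul_neg, neg_neg])
    (fun i j _ => by
      have h : ∀ i j, g k n * x k i * (g k n * x k j) = -(x k i * x k j) := by
        intro i j
        rw [g_mul_x, neg_mul, mul_assoc, ← mul_assoc (g k n), g_mul_g, one_mul]
      rw [← MulOpposite.op_mul, ← MulOpposite.op_mul, ← MulOpposite.op_neg, h, h, x_mul_x j i])

variable (k n) in
/-- The antipode as a linear map. -/
def antipodeLin : EAlg k n →ₗ[k] EAlg k n :=
  (MulOpposite.opLinearEquiv k).symm.toLinearMap ∘ₗ (antipodeHom k n).toLinearMap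

@[simp] theorem antipodeLin_g : antipodeLin k n (g k n) = g k n := by
  simp [antipodeLin, antipodeHom]

@[simp] theorem antipodeLin_x (i : Fin n) : antipodeLin k n (x k i) = g k n * x k i := by
  simp [antipodeLin, antipodeHom]

@[simp] theorem antipodeLin_one : antipodeLin k n 1 = 1 := by
  simp [antipodeLin]

theorem antipodeLin_mul (a b : EAlg k n) :
    antipodeLin k n (a * b) = antipodeLin k n b * antipodeLin k n a := by
  simp [antipodeLin]

theorem antipode_left (a : EAlg k n) :
    LinearMap.mul' k (EAlg k n) ((antipodeLin k n).rTensor _ (comulHom k n a)) =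
      algebraMap k _ (counitHom k n a) := by
  induction a using induction with
  | halg r =>
    simp [Algebra.algebraMap_eq_smul_one, Algebra.TensorProduct.one_def]
  | hg => simp [g_mul_g]
  | hx i => simp [g_mul_x, mul_assoc, g_mul_g]
  | hadd a b ha hb => simp [ha, hb]
  | hmul a b ha hb =>
    have key : ∀ t u : EAlg k n ⊗[k] EAlg k n, ∀ c : k,
        LinearMap.mul' k (EAlg k n) ((antipodeLin k n).rTensor _ t) = algebraMap k _ c →
        LinearMap.mul' k (EAlg k n) ((antipodeLin k n).rTensor _ (t * u)) =
        algebraMap k _ c * LinearMap.mul' k (EAlg k n) ((antipodeLin k n).rTensor _ u) := by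
      intro t u c h
      induction u with
      | zero => simp
      | add u v hu hv => simp only [mul_add, map_add, hu, hv]
      | tmul p q =>
        have h2 : LinearMap.mul' k (EAlg k n) ((antipodeLin k n).rTensor _ (t * p ⊗ₜ q)) =
            antipodeLin k n p * LinearMap.mul' k (EAlg k n) ((antipodeLin k n).rTensor _ t) * q := by
          clear h
          induction t with
          | zero => simp
          | add t s ht hs => simp only [add_mul, mul_add, map_add, ht, hs]
          | tmul r s => simp [antipodeLin_mul, mul_assoc]
        rw [h2, h, ← Algebra.commutes]
        simp [mul_assoc]
    rw [map_mul, key _ _ _ ha, hb, map_mul, map_mul]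

theorem antipode_right (a : EAlg k n) :
    LinearMap.mul' k (EAlg k n) ((antipodeLin k n).lTensor _ (comulHom k n a)) =
      algebraMap k _ (counitHom k n a) := by
  induction a using induction with
  | halg r =>
    simp [Algebra.algebraMap_eq_smul_one, Algebra.TensorProduct.one_def]
  | hg => simp [g_mul_g]
  | hx i => simp [g_mul_x]
  | hadd a b ha hb => simp [ha, hb]
  | hmul a b ha hb =>
    have key : ∀ t u : EAlg k n ⊗[k] EAlg k n, ∀ c : k,
        LinearMap.mul' k (EAlg k n) ((antipodeLin k n).lTensor _ u) = algebraMap k _ c →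
        LinearMap.mul' k (EAlg k n) ((antipodeLin k n).lTensor _ (t * u)) =
        LinearMap.mul' k (EAlg k n) ((antipodeLin k n).lTensor _ t) * algebraMap k _ c := by
      intro t u c h
      induction t with
      | zero => simp
      | add u v hu hv => simp only [add_mul, map_add, hu, hv]
      | tmul p q =>
        have h2 : LinearMap.mul' k (EAlg k n) ((antipodeLin k n).lTensor _ (p ⊗ₜ q * u)) =
            p * LinearMap.mul' k (EAlg k n) ((antipodeLin k n).lTensor _ u) * antipodeLin k n q := by
          clear h
          induction u with
          | zero => simp
          | add t s ht hs => simp only [add_mul, mul_add, map_add, ht, hs]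
          | tmul r s => simp [antipodeLin_mul, mul_assoc]
        rw [h2, h, mul_assoc, Algebra.commutes]
        simp [mul_assoc]
    rw [map_mul, key _ _ _ hb, ha, map_mul, map_mul]

instance : HopfAlgebra k (EAlg k n) where
  antipode := antipodeLin k n
  mul_antipode_rTensor_comul := LinearMap.ext antipode_left
  mul_antipode_lTensor_comul := LinearMap.ext antipode_right

variable (k) in
/-- The element `x_P = x_{i₁} ⋯ x_{iₛ}` for `P = {i₁ < ⋯ < iₛ}`; in particular `x_∅ = 1`. -/
def xP (P : Finset (Fin n)) : EAlg k n :=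
  ((P.sort (· ≤ ·)).map (x k)).prod

end EAlg

/-! ### The coaction attached to a tuple -/

section Coaction

variable {k : Type u} [Field k] {A : Type v} [Ring A] [Algebra k A] {n : ℕ}

/-- The composition `d_P = d_{i₁} ∘ ⋯ ∘ d_{iₛ}` for `P = {i₁ < ⋯ < iₛ}`; in particular `d_∅ = id`. -/
def compDer (d : Fin n → Module.End k A) (P : Finset (Fin n)) : Module.End k A :=
  ((P.sort (· ≤ ·)).map d).prod

open EAlg in
/-- The linear map `A → A ⊗ E(n)` attached to `(φ, d₁, …, dₙ)`. -/
def tupleCoaction (φ : A →ₐ[k] A) (d : Fin n → Module.End k A) : A →ₗ[k] A ⊗[k] EAlg k n where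
  toFun a := ∑ P : Finset (Fin n), (-1 : k) ^ ((P.card + 1) / 2) •
    (compDer d P a ⊗ₜ[k] ((2 : k)⁻¹ • (xP k P + (-1 : k) ^ P.card • (g k n * xP k P))) +
      φ (compDer d P a) ⊗ₜ[k]
        ((2 : k)⁻¹ • (xP k P + (-1 : k) ^ (P.card + 1) • (g k n * xP k P))))
  map_add' a b := by
    simp only [map_add, TensorProduct.add_tmul, ← Finset.sum_add_distrib, ← smul_add]
    refine Finset.sum_congr rfl fun P _ => ?_
    congr 1
    abel
  map_smul' c a := by
    simp only [map_smul, RingHom.id_apply, Finset.smul_sum]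
    refine Finset.sum_congr rfl fun P _ => ?_
    rw [← TensorProduct.smul_tmul', ← TensorProduct.smul_tmul', ← smul_add]
    exact smul_comm _ _ _

end Coaction

end

/-!
Write `H = E(n)`. For a tuple `(φ, d)` the attached map `ρ` factors as the grading coaction
`ρ₀ a = a ⊗ (1 + g) / 2 + φ a ⊗ (1 - g) / 2` followed by the ordered product of the operators
`1 - dᵢ ⊗ (xᵢ g · )` on `A ⊗ H` (`tupleCoaction_apply`): expanding the product gives the sum over
`P`, and moving the factors `g` to one side produces the signs. The factors are multiplicative on a
subset of `A ⊗ H` that contains the image of `ρ₀` and is stable under them, so `ρ` is an algebra map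
(`tupleCoaction_mul`).

The algebra `H` carries a tuple of its own: the involution `parity` and the skew derivations
`skewDer i` with `g ↦ 0`, `xⱼ ↦ -δᵢⱼ`. A commutation argument with the product formula shows that
`ρ` intertwines `φ` with `id ⊗ parity` and `dᵢ` with `id ⊗ skewDer i`
(`tensorParity_tupleCoaction`, `tensorSkewDer_tupleCoaction`). The coaction attached to the tuple of
`H` is the comultiplication, since both are algebra maps which agree on generators
(`tupleCoaction_skewDer`). Thus `id ⊗ Δ` is given by the formula for the operators `id ⊗ parity`,
`id ⊗ skewDer i`, and every `ρ` with the intertwining property satisfies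
`(id ⊗ Δ) ∘ ρ = (ρ ⊗ id) ∘ tupleCoaction φ d` (`lTensor_comul_comp`). All else follows from this:

* for `ρ = tupleCoaction φ d` it is coassociativity;
* the tuple is recovered as `φ a = a₀ ε(parity a₁)`, `dᵢ a = a₀ ε(skewDer i a₁)`, whence injectivity;
* for an arbitrary coaction `ρ` these formulas define operators which `ρ` intertwines with
  `id ⊗ parity` and `id ⊗ skewDer i`. As `ρ` is an injective algebra map, they inherit the relations
  of a tuple from the latter, and comparison with coassociativity gives
  `(ρ ⊗ id) ∘ tupleCoaction φ d = (ρ ⊗ id) ∘ ρ`, where `ρ ⊗ id` is injective.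

No basis of `H` is needed at any point.
-/

noncomputable section

/-! ### The regular tuple: an involution and skew derivations of `E(n)` itself -/

namespace EAlg

variable {k : Type u} [CommRing k] {n : ℕ}

variable (k n) in
/-- The involution `g ↦ -g`, `xᵢ ↦ -xᵢ` of `E(n)`. -/
def parity : EAlg k n →ₐ[k] EAlg k n :=
  lift (-g k n) (fun i => -x k i) (by simp [g_mul_g]) (by simp [x_mul_self]) (by simp [g_mul_x])
    (fun i j _ => by simpa using x_mul_x i j)

@[simp] theorem parity_g : parity k n (g k n) = -g k n := lift_g ..

@[simp] theorem parity_x (i : Fin n) : parity k n (x k i) = -x k i := lift_x ..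

theorem isAlgInvolution_parity : IsAlgInvolution (parity k n) := fun a =>
  DFunLike.congr_fun (f := (parity k n).comp (parity k n)) (g := AlgHom.id k _)
    (algHom_ext (by simp) (by simp)) a

variable (k) in
/-- The algebra map `h ↦ !![parity h, δᵢ h; 0, h]`, whose multiplicativity in the upper right entry
says that `δᵢ` is a skew derivation. -/
def skewDerMatrix (i : Fin n) : EAlg k n →ₐ[k] Matrix (Fin 2) (Fin 2) (EAlg k n) :=
  lift !![-g k n, 0; 0, g k n] (fun j => !![-x k j, if i = j then -1 else 0; 0, x k j])
    (by simp [g_mul_g, Matrix.one_fin_two])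
    (fun j => by ext a b; fin_cases a <;> fin_cases b <;> by_cases h : i = j <;> simp [x_mul_self, h])
    (fun j => by ext a b; fin_cases a <;> fin_cases b <;> by_cases h : i = j <;> simp [g_mul_x, h])
    (fun j l hjl => by
      have h := x_mul_x (k := k) j l
      ext a b; fin_cases a <;> fin_cases b <;>
        by_cases hj : i = j <;> by_cases hl : i = l <;> simp [h, hj, hl, hjl.ne, hjl.ne'])

theorem skewDerMatrix_g (i : Fin n) :
    skewDerMatrix k i (g k n) = !![-g k n, 0; 0, g k n] := lift_g ..

theorem skewDerMatrix_x (i j : Fin n) :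
    skewDerMatrix k i (x k j) = !![-x k j, if i = j then -1 else 0; 0, x k j] := lift_x ..

theorem skewDerMatrix_apply (i : Fin n) (a : EAlg k n) :
    skewDerMatrix k i a 0 0 = parity k n a ∧ skewDerMatrix k i a 1 0 = 0 ∧
      skewDerMatrix k i a 1 1 = a := by
  induction a using induction with
  | halg r => simp [Matrix.algebraMap_matrix_apply]
  | hg => simp [skewDerMatrix_g]
  | hx j => simp [skewDerMatrix_x]
  | hadd a b ha hb => simp [ha, hb]
  | hmul a b ha hb => simp [Matrix.mul_apply, Fin.sum_univ_two, ha, hb]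

variable (k) in
/-- The skew derivation `δᵢ` of `E(n)` with `δᵢ g = 0` and `δᵢ xⱼ = -1` if `i = j`, `0` otherwise. -/
def skewDer (i : Fin n) : Module.End k (EAlg k n) where
  toFun a := skewDerMatrix k i a 0 1
  map_add' := by simp
  map_smul' := by simp

@[simp] theorem skewDer_g (i : Fin n) : skewDer k i (g k n) = 0 := by
  simp [skewDer, skewDerMatrix_g]

@[simp] theorem skewDer_x (i j : Fin n) : skewDer k i (x k j) = if i = j then -1 else 0 := by
  simp [skewDer, skewDerMatrix_x]

@[simp] theorem skewDer_algebraMap (i : Fin n) (r : k) :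
    skewDer k i (algebraMap k _ r) = 0 := by
  simp [skewDer, Matrix.algebraMap_matrix_apply]

@[simp] theorem skewDer_one (i : Fin n) : skewDer k i 1 = 0 := by
  simpa using skewDer_algebraMap (k := k) i 1

theorem isSkewDerivation_skewDer (i : Fin n) :
    IsSkewDerivation (parity k n) (skewDer k i) := fun a b => by
  simp [skewDer, Matrix.mul_apply, Fin.sum_univ_two, (skewDerMatrix_apply i a).1,
    (skewDerMatrix_apply i b).2.2, add_comm]

theorem parity_skewDer (i : Fin n) (a : EAlg k n) :
    parity k n (skewDer k i a) = -skewDer k i (parity k n a) := by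
  induction a using induction with
  | halg r => simp
  | hg => simp
  | hx j => by_cases h : i = j <;> simp [h]
  | hadd a b ha hb => simp [ha, hb, add_comm]
  | hmul a b ha hb =>
    simp only [map_mul, isSkewDerivation_skewDer i _ _, map_add, ha, hb,
      isAlgInvolution_parity a]
    simp [add_comm]

theorem skewDer_skewDer (i j : Fin n) (a : EAlg k n) :
    skewDer k i (skewDer k j a) = -skewDer k j (skewDer k i a) := by
  induction a using induction with
  | halg r => simp
  | hg => simp
  | hx l => by_cases h : i = l <;> by_cases h' : j = l <;> simp [h, h']
  | hadd a b ha hb => simp [ha, hb, add_comm]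
  | hmul a b ha hb =>
    simp only [isSkewDerivation_skewDer _ _ _, map_add, ha, hb, parity_skewDer,
      isAlgInvolution_parity a]
    simp only [neg_mul, mul_neg]
    abel

/-- This follows from `skewDer_skewDer` only where `2` is not a zero divisor. -/
theorem skewDer_sq (i : Fin n) (a : EAlg k n) : skewDer k i (skewDer k i a) = 0 := by
  induction a using induction with
  | halg r => simp
  | hg => simp
  | hx l => by_cases h : i = l <;> simp [h]
  | hadd a b ha hb => simp [ha, hb]
  | hmul a b ha hb =>
    simp [isSkewDerivation_skewDer i _ _, ha, hb, parity_skewDer]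

theorem isInvolutionDerivationTuple_skewDer :
    IsInvolutionDerivationTuple (parity k n) (skewDer k (n := n)) :=
  ⟨isAlgInvolution_parity, isSkewDerivation_skewDer, skewDer_sq, parity_skewDer, skewDer_skewDer⟩

theorem x_mul_g_mul_x_mul_g (i j : Fin n) :
    x k i * g k n * (x k j * g k n) = -(x k i * x k j) := by
  rw [mul_assoc, ← mul_assoc (g k n), g_mul_x, neg_mul, mul_assoc, g_mul_g, mul_one, mul_neg]

end EAlg

/-! ### Ordered products over finite sets -/

/-- The sum over all `P ⊆ s` of the increasingly ordered products of the `c i`, `i ∈ P`, that is,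
the increasingly ordered product of the `1 + c i`, `i ∈ s`
(see `sumOrderedProd_empty` and `sumOrderedProd_insert`). -/
def sumOrderedProd {R : Type*} [Semiring R] {n : ℕ} (c : Fin n → R) (s : Finset (Fin n)) : R :=
  ∑ P ∈ s.powerset, ((P.sort (· ≤ ·)).map c).prod

theorem sumOrderedProd_empty {R : Type*} [Semiring R] {n : ℕ} (c : Fin n → R) :
    sumOrderedProd c ∅ = 1 := by
  simp [sumOrderedProd]

theorem sumOrderedProd_insert {R : Type*} [Semiring R] {n : ℕ} (c : Fin n → R) {m : Fin n}
    {s : Finset (Fin n)} (hm : ∀ j ∈ s, m < j) :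
    sumOrderedProd c (insert m s) = (1 + c m) * sumOrderedProd c s := by
  have hms : m ∉ s := fun h => (hm m h).false
  rw [sumOrderedProd, Finset.sum_powerset_insert hms, add_mul, one_mul, sumOrderedProd,
    Finset.mul_sum]
  congr 1
  refine Finset.sum_congr rfl fun P hP => ?_
  have hP := Finset.mem_powerset.1 hP
  rw [Finset.sort_insert (· ≤ ·) (fun j hj => (hm j (hP hj)).le) (fun h => hms (hP h))]
  simp

theorem commute_sumOrderedProd {R : Type*} [Semiring R] {n : ℕ} (c : Fin n → R)
    (s : Finset (Fin n)) {b : R} (hb : ∀ i ∈ s, Commute b (c i)) :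
    Commute b (sumOrderedProd c s) := by
  induction s using Finset.induction_on_min with
  | empty => simp [sumOrderedProd_empty]
  | insert m s hm ih =>
    rw [sumOrderedProd_insert c hm]
    exact ((Commute.one_right b).add_right (hb m (by simp))).mul_right
      (ih fun i hi => hb i (by simp [hi]))

/-! ### The coaction as a product of commuting operators -/

open EAlg

section Twist

variable {k : Type u} [CommRing k] {A : Type v} [Ring A] [Algebra k A] {n : ℕ}

/-- The operator `a ⊗ h ↦ -dᵢ a ⊗ xᵢ g h` on `A ⊗ E(n)`. -/
def twist (d : Fin n → Module.End k A) (i : Fin n) : Module.End k (A ⊗[k] EAlg k n) :=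
  -TensorProduct.map (d i) (LinearMap.mulLeft k (x k i * g k n))

@[simp] theorem twist_tmul (d : Fin n → Module.End k A) (i : Fin n) (a : A) (h : EAlg k n) :
    twist d i (a ⊗ₜ h) = -(d i a ⊗ₜ (x k i * g k n * h)) := rfl

/-- The algebra map `id ⊗ parity` on `A ⊗ E(n)`. -/
def tensorParity (A : Type v) [Ring A] [Algebra k A] (n : ℕ) :
    A ⊗[k] EAlg k n →ₐ[k] A ⊗[k] EAlg k n :=
  Algebra.TensorProduct.map (AlgHom.id k A) (parity k n)

@[simp] theorem tensorParity_tmul (a : A) (h : EAlg k n) :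
    tensorParity A n (a ⊗ₜ[k] h) = a ⊗ₜ parity k n h := by
  simp [tensorParity]

/-- The operators `id ⊗ δᵢ` on `A ⊗ E(n)`. -/
def tensorSkewDer (A : Type v) [Ring A] [Algebra k A] (i : Fin n) :
    Module.End k (A ⊗[k] EAlg k n) :=
  (skewDer k i).lTensor A

@[simp] theorem tensorSkewDer_tmul (i : Fin n) (a : A) (h : EAlg k n) :
    tensorSkewDer A i (a ⊗ₜ[k] h) = a ⊗ₜ skewDer k i h := rfl

theorem isInvolutionDerivationTuple_tensor :
    IsInvolutionDerivationTuple (tensorParity (k := k) A n) (tensorSkewDer A) where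
  involution t := by
    induction t with
    | zero => simp
    | add t u ht hu => simp [ht, hu]
    | tmul a h => simp [isAlgInvolution_parity h]
  derivation i t u := by
    induction t with
    | zero => simp
    | add t t' ht ht' => simp only [add_mul, map_add, ht, ht']; abel
    | tmul a h =>
      induction u with
      | zero => simp
      | add u u' hu hu' => simp only [mul_add, map_add, hu, hu']; abel
      | tmul b h' => simp [isSkewDerivation_skewDer i h h', TensorProduct.tmul_add]
  sq_zero i t := by
    induction t with
    | zero => simp
    | add t u ht hu => simp [ht, hu]
    | tmul a h => simp [skewDer_sq]
  anticomm_involution i t := by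
    induction t with
    | zero => simp
    | add t u ht hu => simp only [map_add, ht, hu, neg_add]
    | tmul a h => simp [parity_skewDer, TensorProduct.tmul_neg]
  anticomm i j t := by
    induction t with
    | zero => simp
    | add t u ht hu => simp only [map_add, ht, hu, neg_add]
    | tmul a h => simp [skewDer_skewDer i j, TensorProduct.tmul_neg]

variable {φ : A →ₐ[k] A} {d : Fin n → Module.End k A}

theorem tensorParity_twist (i : Fin n) (t : A ⊗[k] EAlg k n) :
    tensorParity A n (twist d i t) = twist d i (tensorParity A n t) := by
  induction t with
  | zero => simp
  | add t u ht hu => simp [ht, hu]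
  | tmul a h => simp

/-- The operator `dᵢ ⊗ (g · )` on `A ⊗ E(n)`. -/
def gTwist (d : Fin n → Module.End k A) (i : Fin n) : Module.End k (A ⊗[k] EAlg k n) :=
  TensorProduct.map (d i) (LinearMap.mulLeft k (g k n))

@[simp] theorem gTwist_tmul (i : Fin n) (a : A) (h : EAlg k n) :
    gTwist d i (a ⊗ₜ h) = d i a ⊗ₜ (g k n * h) := rfl

theorem tensorSkewDer_twist (i j : Fin n) (t : A ⊗[k] EAlg k n) :
    tensorSkewDer A i (twist d j t) =
      twist d j (tensorSkewDer A i t) + if i = j then gTwist d i t else 0 := by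
  induction t with
  | zero => simp
  | add t u ht hu =>
    simp only [map_add, ht, hu]
    split_ifs <;> abel
  | tmul a h =>
    have h1 : skewDer k i (x k j * g k n * h) =
        x k j * g k n * skewDer k i h - if i = j then g k n * h else 0 := by
      rw [isSkewDerivation_skewDer i _ h, isSkewDerivation_skewDer i (x k j)]
      by_cases hij : i = j <;> simp [hij]
      abel
    by_cases hij : i = j
    · subst hij
      simp [h1, TensorProduct.tmul_sub]
      abel
    · simp [h1, hij]

theorem lTensor_counit_twist (i : Fin n) (t : A ⊗[k] EAlg k n) :
    (Coalgebra.counit (R := k) (A := EAlg k n)).lTensor A (twist d i t) = 0 := by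
  induction t with
  | zero => simp
  | add t u ht hu => simp [ht, hu]
  | tmul a h => simp [counit_eq]

/-- The elements `t` of `A ⊗ E(n)` with `t (1 ⊗ xᵢ g) = (φ ⊗ xᵢ g) t` for all `i`. On this set, which
contains the image of the coaction attached to `(φ, d)`, the operators `1 + twist d i` are
multiplicative; on all of `A ⊗ E(n)` they need not be. -/
def IsTwistCentral (φ : A →ₐ[k] A) (t : A ⊗[k] EAlg k n) : Prop :=
  ∀ i, t * (1 ⊗ₜ (x k i * g k n)) =
    TensorProduct.map φ.toLinearMap (LinearMap.mulLeft k (x k i * g k n)) t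

variable (H : IsInvolutionDerivationTuple φ d)
include H

theorem commute_gTwist_twist (i j : Fin n) : Commute (gTwist d i) (twist d j) := by
  refine TensorProduct.ext' fun a h => ?_
  have h1 : g k n * (x k j * g k n * h) = -(x k j * g k n * (g k n * h)) := by
    simp only [← mul_assoc, g_mul_x, neg_mul]
  simp [H.anticomm i j a, TensorProduct.neg_tmul, h1, TensorProduct.tmul_neg]

theorem twist_gTwist_self (i : Fin n) (t : A ⊗[k] EAlg k n) :
    twist d i (gTwist d i t) = 0 := by
  induction t with
  | zero => simp
  | add t u ht hu => simp [ht, hu]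
  | tmul a h => simp [H.sq_zero]

theorem IsTwistCentral.twist {t : A ⊗[k] EAlg k n} (ht : IsTwistCentral φ t) (j : Fin n) :
    IsTwistCentral φ (twist d j t) := by
  intro i
  have h1 : ∀ u : A ⊗[k] EAlg k n,
      _root_.twist d j u * (1 ⊗ₜ (x k i * g k n)) =
        _root_.twist d j (u * (1 ⊗ₜ (x k i * g k n))) := by
    intro u
    induction u with
    | zero => simp
    | add u v hu hv => simp only [map_add, add_mul, hu, hv]
    | tmul a h => simp [mul_assoc]
  rw [h1, ht i]
  clear h1 ht
  induction t with
  | zero => simp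
  | add u v hu hv => simp only [map_add, hu, hv]
  | tmul a h =>
    simp only [TensorProduct.map_tmul, LinearMap.mulLeft_apply, twist_tmul, map_neg,
      AlgHom.toLinearMap_apply, ← mul_assoc (x k _ * g k n) (x k _ * g k n)]
    rw [H.anticomm_involution, x_mul_g_mul_x_mul_g, x_mul_g_mul_x_mul_g, x_mul_x i j]
    simp [TensorProduct.neg_tmul, TensorProduct.tmul_neg]

theorem twist_mul {t : A ⊗[k] EAlg k n} (ht : IsTwistCentral φ t) (i : Fin n)
    (u : A ⊗[k] EAlg k n) : twist d i (t * u) = twist d i t * u + t * twist d i u := by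
  have h1 : ∀ (b : A) (h : EAlg k n), t * (b ⊗ₜ (x k i * g k n * h)) =
      TensorProduct.map φ.toLinearMap (LinearMap.mulLeft k (x k i * g k n)) t * (b ⊗ₜ h) := by
    intro b h
    rw [← ht i, mul_assoc t, Algebra.TensorProduct.tmul_mul_tmul, one_mul]
  induction u with
  | zero => simp
  | add u v hu hv => simp only [mul_add, map_add, hu, hv]; abel
  | tmul b h' =>
    rw [twist_tmul, mul_neg, h1]
    clear h1 ht
    induction t with
    | zero => simp
    | add t t' ht ht' => simp only [add_mul, map_add, ht, ht']; abel
    | tmul a h =>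
      simp [H.derivation i a b, TensorProduct.add_tmul, mul_assoc, add_comm]

theorem twist_mul_twist {t : A ⊗[k] EAlg k n} (ht : IsTwistCentral φ t) (i : Fin n)
    (u : A ⊗[k] EAlg k n) : twist d i t * twist d i u = 0 := by
  have h1 : twist d i t * (1 ⊗ₜ (x k i * g k n)) = 0 := by
    rw [ht.twist H i i]
    clear ht
    induction t with
    | zero => simp
    | add t u ht hu => rw [map_add, map_add, ht, hu, add_zero]
    | tmul a h =>
      simp only [twist_tmul, map_neg, TensorProduct.map_tmul, LinearMap.mulLeft_apply,
        ← mul_assoc (x k i * g k n) (x k i * g k n)]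
      simp [x_mul_g_mul_x_mul_g, x_mul_self]
  induction u with
  | zero => simp
  | add u v hu hv => simp [mul_add, hu, hv]
  | tmul b h =>
    have h2 : (d i b ⊗ₜ[k] (x k i * g k n * h) : A ⊗[k] EAlg k n) =
        (1 ⊗ₜ (x k i * g k n)) * (d i b ⊗ₜ h) := by simp
    rw [twist_tmul, h2, mul_neg, ← mul_assoc, h1, zero_mul, neg_zero]

theorem one_add_twist_mul {t : A ⊗[k] EAlg k n} (ht : IsTwistCentral φ t) (i : Fin n)
    (u : A ⊗[k] EAlg k n) :
    (1 + twist d i) (t * u) = (1 + twist d i) t * (1 + twist d i) u := by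
  simp [twist_mul H ht, mul_add, add_mul, twist_mul_twist H ht]
  abel

theorem sumOrderedProd_twist_mul (s : Finset (Fin n)) {t : A ⊗[k] EAlg k n}
    (ht : IsTwistCentral φ t) (u : A ⊗[k] EAlg k n) :
    IsTwistCentral φ (sumOrderedProd (twist d) s t) ∧
      sumOrderedProd (twist d) s (t * u) =
        sumOrderedProd (twist d) s t * sumOrderedProd (twist d) s u := by
  induction s using Finset.induction_on_min with
  | empty => simpa [sumOrderedProd_empty] using ht
  | insert m s hm ih =>
    rw [sumOrderedProd_insert _ hm]
    simp only [Module.End.mul_apply, ih.2, one_add_twist_mul H ih.1, and_true]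
    intro i
    simp [add_mul, ih.1 i, ih.1.twist H m i]

theorem tensorSkewDer_sumOrderedProd (i : Fin n) (s : Finset (Fin n)) (t : A ⊗[k] EAlg k n) :
    tensorSkewDer A i (sumOrderedProd (twist d) s t) =
      sumOrderedProd (twist d) s (tensorSkewDer A i t + if i ∈ s then gTwist d i t else 0) := by
  induction s using Finset.induction_on_min with
  | empty => simp [sumOrderedProd_empty]
  | insert m s hm ih =>
    have hc : gTwist d i (sumOrderedProd (twist d) s t) =
        sumOrderedProd (twist d) s (gTwist d i t) :=
      DFunLike.congr_fun (commute_sumOrderedProd (twist d) s (b := gTwist d i)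
        fun j _ => commute_gTwist_twist H i j) t
    have hms : m ∉ s := fun h => (hm m h).false
    rw [sumOrderedProd_insert _ hm]
    simp only [Module.End.mul_apply, LinearMap.add_apply, Module.End.one_apply, map_add,
      tensorSkewDer_twist, ih, Finset.mem_insert]
    by_cases hi : i = m
    · subst hi
      simp [hms, hc]
      simp only [← hc, twist_gTwist_self H]
      abel
    · by_cases his : i ∈ s <;> simp [hi, his]
      abel

end Twist

/-! ### Multiplicativity and equivariance of the attached coaction -/

section Field

variable {k : Type u} [Field k] {A : Type v} [Ring A] [Algebra k A] {n : ℕ}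

/-- The coaction `a ↦ a ⊗ (1 + g) / 2 + φ a ⊗ (1 - g) / 2`. -/
def involutionCoaction (n : ℕ) (φ : A →ₐ[k] A) : A →ₗ[k] A ⊗[k] EAlg k n :=
  (TensorProduct.mk k A (EAlg k n)).flip ((2 : k)⁻¹ • (1 + g k n)) +
    (TensorProduct.mk k A (EAlg k n)).flip ((2 : k)⁻¹ • (1 - g k n)) ∘ₗ φ.toLinearMap

theorem involutionCoaction_apply (φ : A →ₐ[k] A) (a : A) :
    involutionCoaction n φ a =
      a ⊗ₜ ((2 : k)⁻¹ • (1 + g k n)) + φ a ⊗ₜ ((2 : k)⁻¹ • (1 - g k n)) := rfl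

variable {φ : A →ₐ[k] A} {d : Fin n → Module.End k A}

theorem prod_twist_involutionCoaction (H : IsInvolutionDerivationTuple φ d) (l : List (Fin n))
    (a : A) :
    (l.map (twist d)).prod (involutionCoaction n φ a) = (-1 : k) ^ ((l.length + 1) / 2) •
      ((l.map d).prod a ⊗ₜ[k] ((2 : k)⁻¹ • ((l.map (x k)).prod +
          (-1 : k) ^ l.length • (g k n * (l.map (x k)).prod))) +
        φ ((l.map d).prod a) ⊗ₜ[k] ((2 : k)⁻¹ • ((l.map (x k)).prod +
          (-1 : k) ^ (l.length + 1) • (g k n * (l.map (x k)).prod)))) := by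
  induction l with
  | nil => simp [involutionCoaction_apply, sub_eq_add_neg]
  | cons i l ih =>
    have hg : ∀ y : EAlg k n, x k i * g k n * (g k n * y) = x k i * y := fun y => by
      rw [mul_assoc, ← mul_assoc (g k n) (g k n), g_mul_g, one_mul]
    have hx : ∀ y : EAlg k n, g k n * (x k i * y) = -(x k i * g k n * y) := fun y => by
      rw [← mul_assoc, g_mul_x, neg_mul]
    have hd : ∀ b, d i (φ b) = -φ (d i b) := fun b => by rw [H.anticomm_involution, neg_neg]
    rw [List.map_cons, List.prod_cons, Module.End.mul_apply, ih]
    simp only [List.map_cons, List.prod_cons, Module.End.mul_apply, List.length_cons, map_smul,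
      map_add, twist_tmul, mul_smul_comm, mul_add, hg, hx, hd]
    -- all signs depend only on the length of `l` modulo 4
    obtain ⟨q, r, hr, hl⟩ : ∃ q r, r < 4 ∧ l.length = 4 * q + r :=
      ⟨l.length / 4, l.length % 4, Nat.mod_lt _ (by norm_num), by omega⟩
    have h4 : ∀ s, (-1 : k) ^ (4 * q + s) = (-1) ^ s := fun s => by
      rw [pow_add, pow_mul]; norm_num
    have h2 : ∀ s, (4 * q + s) / 2 = 2 * q + s / 2 := by omega
    have h2' : ∀ s, (-1 : k) ^ (2 * q + s) = (-1) ^ q * (-1) ^ q * (-1) ^ s := fun s => by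
      ring
    have hq : (-1 : k) ^ q * (-1) ^ q = 1 := by rw [← mul_pow]; simp
    simp only [hl, add_assoc, h4, h2, h2', hq, one_mul]
    interval_cases r <;>
      simp only [TensorProduct.tmul_add, TensorProduct.tmul_smul, TensorProduct.neg_tmul,
        TensorProduct.tmul_neg] <;>
      module

theorem tupleCoaction_apply (H : IsInvolutionDerivationTuple φ d) (a : A) :
    tupleCoaction φ d a = sumOrderedProd (twist d) Finset.univ (involutionCoaction n φ a) := by
  simp only [sumOrderedProd, Finset.powerset_univ, LinearMap.sum_apply, tupleCoaction,
    LinearMap.coe_mk, AddHom.coe_mk]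
  refine Finset.sum_congr rfl fun P _ => ?_
  rw [prod_twist_involutionCoaction H, Finset.length_sort]
  rfl

theorem inv_two_smul_add_self {M : Type*} [AddCommGroup M] [Module k M] (h2 : (2 : k) ≠ 0)
    (m : M) : (2 : k)⁻¹ • (m + m) = m := by
  rw [← two_smul k m, smul_smul, inv_mul_cancel₀ h2, one_smul]

theorem isTwistCentral_involutionCoaction (H : IsInvolutionDerivationTuple φ d) (a : A) :
    IsTwistCentral (n := n) φ (involutionCoaction n φ a) := by
  intro i
  simp only [involutionCoaction_apply, add_mul, mul_add, mul_sub, sub_mul,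
    Algebra.TensorProduct.tmul_mul_tmul, mul_one, one_mul,
    map_add, TensorProduct.map_tmul, LinearMap.mulLeft_apply, mul_smul_comm, smul_mul_assoc,
    AlgHom.toLinearMap_apply, H.involution a]
  have h1 : g k n * (x k i * g k n) = -x k i := by
    rw [← mul_assoc, g_mul_x, neg_mul, mul_assoc, g_mul_g, mul_one]
  have h2 : x k i * g k n * g k n = x k i := by rw [mul_assoc, g_mul_g, mul_one]
  rw [h1, h2, sub_neg_eq_add, ← sub_eq_add_neg, add_comm]

theorem involutionCoaction_mul (h2 : (2 : k) ≠ 0) (a b : A) :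
    involutionCoaction n φ (a * b) = involutionCoaction n φ a * involutionCoaction n φ b := by
  have h4 : (2 : k)⁻¹ * (2 : k)⁻¹ + (2 : k)⁻¹ * (2 : k)⁻¹ = (2 : k)⁻¹ := by field_simp; norm_num
  have e1 : ((2 : k)⁻¹ • (1 + g k n)) * ((2 : k)⁻¹ • (1 + g k n)) = (2 : k)⁻¹ • (1 + g k n) := by
    simp only [smul_mul_smul_comm, mul_add, add_mul, g_mul_g, one_mul, mul_one]
    nth_rw 3 [← h4]
    module
  have e2 : ((2 : k)⁻¹ • (1 - g k n)) * ((2 : k)⁻¹ • (1 - g k n)) = (2 : k)⁻¹ • (1 - g k n) := by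
    simp only [smul_mul_smul_comm, mul_sub, sub_mul, g_mul_g, one_mul, mul_one]
    nth_rw 3 [← h4]
    module
  have e3 : ((2 : k)⁻¹ • (1 + g k n)) * ((2 : k)⁻¹ • (1 - g k n)) = 0 := by
    simp [mul_sub, add_mul, g_mul_g, add_comm]
  have e4 : ((2 : k)⁻¹ • (1 - g k n)) * ((2 : k)⁻¹ • (1 + g k n)) = 0 := by
    simp only [smul_mul_smul_comm, mul_add, sub_mul, g_mul_g, one_mul, mul_one]
    module
  simp only [involutionCoaction_apply, mul_add, add_mul, Algebra.TensorProduct.tmul_mul_tmul,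
    e1, e2, e3, e4, TensorProduct.tmul_zero, add_zero, zero_add, map_mul]

theorem tupleCoaction_mul (h2 : (2 : k) ≠ 0) (H : IsInvolutionDerivationTuple φ d) (a b : A) :
    tupleCoaction φ d (a * b) = tupleCoaction φ d a * tupleCoaction φ d b := by
  simp only [tupleCoaction_apply H]
  rw [involutionCoaction_mul h2,
    (sumOrderedProd_twist_mul H _ (isTwistCentral_involutionCoaction H a) _).2]

theorem sumOrderedProd_twist_of_forall {s : Finset (Fin n)} {t : A ⊗[k] EAlg k n}
    (ht : ∀ i, twist d i t = 0) : sumOrderedProd (twist d) s t = t := by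
  induction s using Finset.induction_on_min with
  | empty => simp [sumOrderedProd_empty]
  | insert m s hm ih => simp [sumOrderedProd_insert _ hm, ih, ht]

theorem involutionCoaction_of_fixed (h2 : (2 : k) ≠ 0) {a : A} (ha : φ a = a) :
    involutionCoaction n φ a = a ⊗ₜ 1 := by
  rw [involutionCoaction_apply, ha, ← TensorProduct.tmul_add, ← smul_add]
  have : (1 + g k n) + (1 - g k n) = 1 + 1 := by abel
  rw [this, inv_two_smul_add_self h2]

theorem involutionCoaction_of_neg (h2 : (2 : k) ≠ 0) {a : A} (ha : φ a = -a) :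
    involutionCoaction n φ a = a ⊗ₜ g k n := by
  rw [involutionCoaction_apply, ha, TensorProduct.neg_tmul, ← sub_eq_add_neg,
    ← TensorProduct.tmul_sub, ← smul_sub]
  have : (1 + g k n) - (1 - g k n) = g k n + g k n := by abel
  rw [this, inv_two_smul_add_self h2]

theorem IsSkewDerivation.map_one {e : Module.End k A} (he : IsSkewDerivation φ e) : e 1 = 0 := by
  simpa using he 1 1

theorem tupleCoaction_one (h2 : (2 : k) ≠ 0) (H : IsInvolutionDerivationTuple φ d) :
    tupleCoaction φ d 1 = 1 ⊗ₜ 1 := by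
  rw [tupleCoaction_apply H, involutionCoaction_of_fixed h2 (_root_.map_one φ),
    sumOrderedProd_twist_of_forall]
  intro i
  simp [(H.derivation i).map_one]

theorem lTensor_counit_tupleCoaction (h2 : (2 : k) ≠ 0) (H : IsInvolutionDerivationTuple φ d)
    (a : A) :
    (Coalgebra.counit (R := k) (A := EAlg k n)).lTensor A (tupleCoaction φ d a) = a ⊗ₜ 1 := by
  have key : ∀ (s : Finset (Fin n)) (t : A ⊗[k] EAlg k n),
      (Coalgebra.counit (R := k) (A := EAlg k n)).lTensor A (sumOrderedProd (twist d) s t) =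
        (Coalgebra.counit (R := k) (A := EAlg k n)).lTensor A t := by
    intro s t
    induction s using Finset.induction_on_min with
    | empty => simp [sumOrderedProd_empty]
    | insert m s hm ih =>
      rw [sumOrderedProd_insert _ hm, Module.End.mul_apply, LinearMap.add_apply, map_add,
        Module.End.one_apply, ih, lTensor_counit_twist, add_zero]
  rw [tupleCoaction_apply H, key, involutionCoaction_apply]
  have : (2 : k)⁻¹ + (2 : k)⁻¹ = 1 := by rw [← two_mul, mul_inv_cancel₀ h2]
  simp [counit_eq, this]

theorem tensorParity_tupleCoaction (H : IsInvolutionDerivationTuple φ d) (a : A) :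
    tensorParity A n (tupleCoaction φ d a) = tupleCoaction φ d (φ a) := by
  rw [tupleCoaction_apply H, tupleCoaction_apply H]
  have hc : Commute (tensorParity (k := k) A n).toLinearMap
      (sumOrderedProd (twist d) Finset.univ) :=
    commute_sumOrderedProd (R := Module.End k (A ⊗[k] EAlg k n)) _ _ fun i _ =>
      LinearMap.ext (tensorParity_twist i)
  refine (DFunLike.congr_fun hc (involutionCoaction n φ a)).trans ?_
  rw [Module.End.mul_apply]
  congr 1
  simp [involutionCoaction_apply, H.involution a, add_comm, sub_eq_add_neg]

theorem tensorSkewDer_tupleCoaction (H : IsInvolutionDerivationTuple φ d) (i : Fin n) (a : A) :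
    tensorSkewDer A i (tupleCoaction φ d a) = tupleCoaction φ d (d i a) := by
  rw [tupleCoaction_apply H, tupleCoaction_apply H, tensorSkewDer_sumOrderedProd H]
  congr 1
  have hd : d i (φ a) = -φ (d i a) := by rw [H.anticomm_involution, neg_neg]
  have h1 : skewDer k i ((2 : k)⁻¹ • (1 - g k n)) = 0 := by simp
  have h3 : skewDer k i ((2 : k)⁻¹ • (1 + g k n)) = 0 := by simp
  have h4 : (2 : k)⁻¹ • (g k n - 1) = -((2 : k)⁻¹ • (1 - g k n)) := by rw [← smul_neg, neg_sub]
  simp only [involutionCoaction_apply, map_add, tensorSkewDer_tmul, h1, h3, gTwist_tmul,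
    Finset.mem_univ, if_true, hd, mul_smul_comm, mul_add, mul_sub, g_mul_g, mul_one, h4,
    TensorProduct.tmul_zero, add_zero, zero_add, TensorProduct.neg_tmul, TensorProduct.tmul_neg,
    neg_neg, add_comm (g k n) 1]

/-- The comultiplication of `E(n)` is the coaction attached to the regular tuple: both are algebra
maps, and they agree on the generators. -/
theorem tupleCoaction_skewDer (h2 : (2 : k) ≠ 0) :
    tupleCoaction (parity k n) (skewDer k) = Coalgebra.comul (R := k) (A := EAlg k n) := by
  have H := isInvolutionDerivationTuple_skewDer (k := k) (n := n)
  let f : EAlg k n →ₐ[k] EAlg k n ⊗[k] EAlg k n :=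
    AlgHom.ofLinearMap (tupleCoaction (parity k n) (skewDer k)) (tupleCoaction_one h2 H)
      (tupleCoaction_mul h2 H)
  have hf : f = comulHom k n := by
    refine algHom_ext ?_ fun i => ?_
    · refine (tupleCoaction_apply H (g k n)).trans ?_
      rw [involutionCoaction_of_neg h2 parity_g, sumOrderedProd_twist_of_forall, comulHom_g]
      simp
    · refine (tupleCoaction_apply H (x k i)).trans ?_
      have key : ∀ s : Finset (Fin n), sumOrderedProd (twist (skewDer k)) s (x k i ⊗ₜ g k n) =
          x k i ⊗ₜ g k n + if i ∈ s then 1 ⊗ₜ x k i else 0 := by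
        intro s
        induction s using Finset.induction_on_min with
        | empty => simp [sumOrderedProd_empty]
        | insert m s hm ih =>
          have hms : m ∉ s := fun h => (hm m h).false
          by_cases hi : i = m
          · subst hi
            simp [sumOrderedProd_insert _ hm, ih, hms, mul_assoc, g_mul_g,
              TensorProduct.neg_tmul]
          · by_cases his : i ∈ s <;>
              simp [sumOrderedProd_insert _ hm, ih, his, hi, Ne.symm hi]
      rw [involutionCoaction_of_neg h2 (parity_x i), key, comulHom_x]
      simp
  ext1 a
  exact DFunLike.congr_fun hf a

/-! ### Coassociativity -/

theorem map_compDer {B : Type*} [Ring B] [Algebra k B] {D : Fin n → Module.End k B}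
    {f : A →ₗ[k] B} (hd : ∀ i a, f (d i a) = D i (f a)) (P : Finset (Fin n)) (a : A) :
    f (compDer d P a) = compDer D P (f a) := by
  rw [compDer, compDer]
  induction P.sort (· ≤ ·) with
  | nil => simp
  | cons i l ih => simp [hd, ih]

/-- A linear map that intertwines two tuples intertwines the attached coactions. -/
theorem rTensor_tupleCoaction {B : Type*} [Ring B] [Algebra k B] {ψ : B →ₐ[k] B}
    {D : Fin n → Module.End k B} {f : A →ₗ[k] B} (hφ : ∀ a, f (φ a) = ψ (f a))
    (hd : ∀ i a, f (d i a) = D i (f a)) (a : A) :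
    f.rTensor (EAlg k n) (tupleCoaction φ d a) = tupleCoaction ψ D (f a) := by
  simp only [tupleCoaction, LinearMap.coe_mk, AddHom.coe_mk, map_sum, map_smul, map_add,
    LinearMap.rTensor_tmul, hφ, map_compDer hd]

theorem lTensor_comul_eq (h2 : (2 : k) ≠ 0) (t : A ⊗[k] EAlg k n) :
    (Coalgebra.comul (R := k) (A := EAlg k n)).lTensor A t =
      TensorProduct.assoc k A _ _ (tupleCoaction (tensorParity A n) (tensorSkewDer A) t) := by
  induction t with
  | zero => simp
  | add t u ht hu => simp only [map_add, ht, hu]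
  | tmul a h =>
    have h1 := rTensor_tupleCoaction (φ := parity k n) (d := skewDer k)
      (ψ := tensorParity A n) (D := tensorSkewDer A)
      (f := TensorProduct.mk k A (EAlg k n) a) (by simp) (by simp) h
    rw [TensorProduct.mk_apply] at h1
    rw [← h1, tupleCoaction_skewDer h2, LinearMap.lTensor_tmul]
    induction Coalgebra.comul (R := k) h with
    | zero => simp
    | add t u ht hu => simp only [map_add, TensorProduct.tmul_add, ht, hu]
    | tmul p q => simp

/-- A linear map `ρ` that intertwines `(φ, d)` with `id ⊗ parity` and the `id ⊗ δᵢ` satisfies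
`(id ⊗ Δ) ∘ ρ = (ρ ⊗ id) ∘ tupleCoaction φ d`. -/
theorem lTensor_comul_comp (h2 : (2 : k) ≠ 0) {ρ : A →ₗ[k] A ⊗[k] EAlg k n}
    (hφ : ∀ a, ρ (φ a) = tensorParity A n (ρ a))
    (hd : ∀ i a, ρ (d i a) = tensorSkewDer A i (ρ a)) :
    (TensorProduct.assoc k A (EAlg k n) (EAlg k n)).toLinearMap ∘ₗ
      ρ.rTensor (EAlg k n) ∘ₗ tupleCoaction φ d =
      (Coalgebra.comul (R := k) (A := EAlg k n)).lTensor A ∘ₗ ρ := by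
  ext1 a
  simp only [LinearMap.comp_apply, lTensor_comul_eq h2, rTensor_tupleCoaction hφ hd]
  rfl

theorem isComoduleAlgebra_tupleCoaction (h2 : (2 : k) ≠ 0)
    (H : IsInvolutionDerivationTuple φ d) : IsComoduleAlgebra (tupleCoaction φ d) where
  coassoc := lTensor_comul_comp h2 (fun a => (tensorParity_tupleCoaction H a).symm)
    (fun i a => (tensorSkewDer_tupleCoaction H i a).symm)
  counit := by
    ext1 a
    simp [lTensor_counit_tupleCoaction h2 H]
  map_mul := tupleCoaction_mul h2 H
  map_one := tupleCoaction_one h2 H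

/-! ### The tuple attached to a coaction -/

/-- The operator `a ↦ a₀ ε(θ a₁)` on `A`, for a linear map `ρ a = a₀ ⊗ a₁` and an operator `θ` on
`E(n)`. -/
def coactionOperator (ρ : A →ₗ[k] A ⊗[k] EAlg k n) (θ : Module.End k (EAlg k n)) :
    Module.End k A :=
  (TensorProduct.rid k A).toLinearMap ∘ₗ
    (Coalgebra.counit (R := k) (A := EAlg k n) ∘ₗ θ).lTensor A ∘ₗ ρ

theorem coactionOperator_eq {ρ : A →ₗ[k] A ⊗[k] EAlg k n}
    (hρ : (TensorProduct.rid k A).toLinearMap ∘ₗ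
      (Coalgebra.counit (R := k) (A := EAlg k n)).lTensor A ∘ₗ ρ = LinearMap.id)
    {θ : Module.End k (EAlg k n)} {T : Module.End k A} (hT : ∀ a, θ.lTensor A (ρ a) = ρ (T a)) :
    coactionOperator ρ θ = T := by
  ext1 a
  simp only [coactionOperator, LinearMap.comp_apply, LinearMap.lTensor_comp, hT]
  exact DFunLike.congr_fun hρ (T a)

/-- For `θ` left `E(n)`-colinear, a coaction `ρ` intertwines `coactionOperator ρ θ` with `id ⊗ θ`:
both sides of the identity are `a₀ ⊗ a₁ ε(θ a₂)`. -/
theorem coaction_coactionOperator {ρ : A →ₗ[k] A ⊗[k] EAlg k n} (hρ : IsComoduleAlgebra ρ)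
    {θ : Module.End k (EAlg k n)}
    (hθ : ∀ h, θ.lTensor (EAlg k n) (Coalgebra.comul (R := k) h) = Coalgebra.comul (R := k) (θ h))
    (a : A) : ρ (coactionOperator ρ θ a) = θ.lTensor A (ρ a) := by
  have hθ' : coactionOperator (Coalgebra.comul (R := k) (A := EAlg k n)) θ = θ := by
    refine coactionOperator_eq ?_ hθ
    ext1 h
    simp
  have h1 : ∀ t : A ⊗[k] EAlg k n,
      ρ (TensorProduct.rid k A ((Coalgebra.counit (R := k) ∘ₗ θ).lTensor A t)) =
        ((TensorProduct.rid k (EAlg k n)).toLinearMap ∘ₗ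
          (Coalgebra.counit (R := k) ∘ₗ θ).lTensor (EAlg k n)).lTensor A
            (TensorProduct.assoc k A _ _ (ρ.rTensor (EAlg k n) t)) := by
    intro t
    induction t with
    | zero => simp
    | add t u ht hu => simp only [map_add, ht, hu]
    | tmul b h =>
      simp only [LinearMap.lTensor_tmul, LinearMap.rTensor_tmul, TensorProduct.rid_tmul, map_smul]
      induction ρ b with
      | zero => simp
      | add t u ht hu => simp only [map_add, TensorProduct.add_tmul, smul_add, ht, hu]
      | tmul c h' => simp
  refine (h1 (ρ a)).trans ?_
  have h3 := DFunLike.congr_fun hρ.coassoc a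
  simp only [LinearMap.comp_apply, LinearEquiv.coe_coe] at h3
  rw [h3, ← LinearMap.comp_apply, ← LinearMap.lTensor_comp, LinearMap.comp_assoc]
  exact congrArg (fun e => LinearMap.lTensor A e (ρ a)) hθ'

theorem coactionOperator_parity_tupleCoaction (h2 : (2 : k) ≠ 0)
    (H : IsInvolutionDerivationTuple φ d) :
    coactionOperator (tupleCoaction φ d) (parity k n).toLinearMap = φ.toLinearMap :=
  coactionOperator_eq (isComoduleAlgebra_tupleCoaction h2 H).counit
    (tensorParity_tupleCoaction H)

theorem coactionOperator_skewDer_tupleCoaction (h2 : (2 : k) ≠ 0)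
    (H : IsInvolutionDerivationTuple φ d) (i : Fin n) :
    coactionOperator (tupleCoaction φ d) (skewDer k i) = d i :=
  coactionOperator_eq (isComoduleAlgebra_tupleCoaction h2 H).counit
    (tensorSkewDer_tupleCoaction H i)

theorem exists_tupleCoaction_eq (h2 : (2 : k) ≠ 0) {ρ : A →ₗ[k] A ⊗[k] EAlg k n}
    (hρ : IsComoduleAlgebra ρ) :
    ∃ (φ : A →ₐ[k] A) (d : Fin n → Module.End k A),
      IsInvolutionDerivationTuple φ d ∧ tupleCoaction φ d = ρ := by
  have HE := isInvolutionDerivationTuple_skewDer (k := k) (n := n)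
  have HT := isInvolutionDerivationTuple_tensor (k := k) (A := A) (n := n)
  have hinj : Function.Injective ρ :=
    Function.LeftInverse.injective (g := (TensorProduct.rid k A).toLinearMap ∘ₗ
      (Coalgebra.counit (R := k) (A := EAlg k n)).lTensor A) (DFunLike.congr_fun hρ.counit)
  let T := coactionOperator ρ (parity k n).toLinearMap
  let d : Fin n → Module.End k A := fun i => coactionOperator ρ (skewDer k i)
  have hT : ∀ a, ρ (T a) = tensorParity A n (ρ a) := by
    refine fun a => (coaction_coactionOperator hρ (fun h => ?_) a).trans rfl
    rw [← tupleCoaction_skewDer h2]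
    exact tensorParity_tupleCoaction HE h
  have hd : ∀ i a, ρ (d i a) = tensorSkewDer A i (ρ a) := by
    refine fun i a => coaction_coactionOperator hρ (fun h => ?_) a
    rw [← tupleCoaction_skewDer h2]
    exact tensorSkewDer_tupleCoaction HE i h
  let φ : A →ₐ[k] A := AlgHom.ofLinearMap T
    (hinj (by rw [hT, hρ.map_one, ← Algebra.TensorProduct.one_def, map_one]))
    (fun a b => hinj (by simp only [hT, hρ.map_mul, map_mul]))
  have hφ : ∀ a, ρ (φ a) = tensorParity A n (ρ a) := hT
  refine ⟨φ, d, ⟨fun a => hinj ?_, fun i a b => hinj ?_, fun i a => hinj ?_, fun i a => hinj ?_,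
    fun i j a => hinj ?_⟩, ?_⟩
  · rw [hφ, hφ, HT.involution]
  · simp only [map_add, hρ.map_mul, hd, hφ, HT.derivation i (ρ a)]
  · rw [hd, hd, HT.sq_zero, map_zero]
  · rw [map_neg, hd, hφ, hφ, hd, HT.anticomm_involution]
  · rw [map_neg, hd, hd, hd, hd, HT.anticomm]
  · -- `ρ ⊗ id` is injective and takes the same values on both sides
    have h1 := (lTensor_comul_comp h2 hφ hd).trans hρ.coassoc.symm
    ext1 a
    have h3 := (TensorProduct.assoc k A (EAlg k n) (EAlg k n)).injective
      (DFunLike.congr_fun h1 a)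
    refine Module.Flat.rTensor_preserves_injective_linearMap ρ hinj h3

end Field

end

theorem theorem4p5 {k : Type u} [Field k] (hk : ringChar k ≠ 2) {A : Type v} [Ring A] [Algebra k A]
    [FiniteDimensional k A] (n : ℕ) :
    Set.BijOn
      (fun p : (A →ₐ[k] A) × (Fin n → Module.End k A) => tupleCoaction p.1 p.2)
      {p | IsInvolutionDerivationTuple p.1 p.2}
      {ρ : A →ₗ[k] A ⊗[k] EAlg k n | IsComoduleAlgebra ρ} := by
  have h2 : (2 : k) ≠ 0 := Ring.two_ne_zero hk
  refine ⟨fun p hp => isComoduleAlgebra_tupleCoaction h2 hp, ?_, fun ρ hρ => ?_⟩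
  · rintro ⟨φ, d⟩ H ⟨φ', d'⟩ H' (h : tupleCoaction φ d = tupleCoaction φ' d')
    refine Prod.ext (AlgHom.toLinearMap_injective ?_) (funext fun i => ?_)
    · exact (coactionOperator_parity_tupleCoaction h2 H).symm.trans
        (h ▸ coactionOperator_parity_tupleCoaction h2 H')
    · exact (coactionOperator_skewDer_tupleCoaction h2 H i).symm.trans
        (h ▸ coactionOperator_skewDer_tupleCoaction h2 H' i)
  · obtain ⟨φ, d, H, h⟩ := exists_tupleCoaction_eq h2 hρ
    exact ⟨(φ, d), H, h⟩
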